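/- An $\ell$-space is a Hausdorff, locally compact, totally disconnected, second countable topological space; an $\ell$-group is a topological group whose underlying space is an $\ell$-space; a character of an $\ell$-group $G$ is a homomorphism $\chi:G\to\mathbb C^\times$ that is continuous for the discrete topology on $\mathbb C^\times$. For a representation $V$ of $G$ let $G$ act from the right on $V^*=\mathrm{Hom}_{\mathbb C}(V,\mathbb C)$ by $(\xi\cdot g)(v)=\xi(g\cdot v)$, let $(V^*)^{\chi,k}$ be the space of $\xi\in V^*$ with $\xi\cdot(g_0-\chi(g_0))(g_1-\chi(g_1))\cdots(g_k-\chi(g_k))=0$ for all $g_0,\dots,g_k\in G$, and let $(V^*)^{\chi,\infty}=\bigcup_{k\ge 0}(V^*)^{\chi,k}$. If $G$ acts continuously on an $\ell$-space $X$, let $D(X)=S(X)^*$, where $S(X)$ is the space of locally constant compactly supported functions $X\to\mathbb C$ with $(g\cdot\phi)(x)=\phi(g^{-1}x)$; use the same notation for an orbit $\mathrm O\subseteq X$ with the subspace topology. A $G$-equivariant $\ell$-sheaf $\mathcal F$ on $X$ is a sheaf of complex vector spaces on $X$ with a continuous action of $G$ on its étalé space $\bigsqcup_x\mathcal F_x$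 such that each $g$ restricts to linear maps $\mathcal F_x\to\mathcal F_{gx}$. For a $G$-stable closed subset $Z\subseteq X$ let $D(Z,\mathcal F)=\Gamma_c(Z,\mathcal F|_Z)^*$, where $\Gamma_c(Z,\mathcal F|_Z)$ is the space of compactly supported continuous sections over $Z$ of the étalé space, with $(g\cdot s)_z=g\cdot s_{g^{-1}z}$. Let $G$ be an $\ell$-group acting continuously on an $\ell$-space $X$, let $Y$ be an $\ell$-space, and let $\pi:X\to Y$ be a continuous map with $\pi(g x)=\pi(x)$ for all $g\in G$, $x\in X$. Let $\chi$ be a character of $G$ and let $g_1,\dots,g_n\in G$. (1) For every $G$-equivariant $\ell$-sheaf $\mathcal F$ on $X$: if $(g_1-\chi(g_1))\cdots(g_n-\chi(g_n))$ acts by zero on $D(\pi^{-1}(y),\mathcal F)^{\chi,\infty}$ for every $y\in Y$, then it acts by zero on $D(X,\mathcal F)^{\chi,\infty}$. (2) Suppose that for every $y\in Y$ the fiber $\pi^{-1}(y)$ is a disjoint union of finitely many closed $G$-orbits. If $(g_1-\chi(g_1))\cdots(g_n-\chi(g_n))$ acts by zero on $D(\mathrm O)^{\chi,\infty}$ for every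 $G$-orbit $\mathrm O$ in $X$, then it acts by zero on $D(X)^{\chi,\infty}$. -/

import Mathlib

open CategoryTheory TopologicalSpace Opposite Topology

universe u

/-- An `ℓ`-space: a Hausdorff, locally compact, totally disconnected and second countable
topological space. -/
class IsLSpace (X : Type*) [TopologicalSpace X] : Prop extends
  T2Space X, LocallyCompactSpace X, TotallyDisconnectedSpace X, SecondCountableTopology X

/-- An `ℓ`-group: a topological group whose underlying topological space is an `ℓ`-space. -/
class IsLGroup (G : Type*) [Group G] [TopologicalSpace G] : Prop extends
  IsTopologicalGroup G, IsLSpace G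

section GeneralizedInvariants

variable {G : Type*} [Group G] {V : Type*} [AddCommGroup V] [Module ℂ V]

/-- The right action `ξ ↦ ξ · g` on linear functionals on a `G`-representation,
`(ξ · g)(φ) = ξ (g · φ)`. -/
def dualRightAct (ρ : Representation ℂ G V) (ξ : Module.Dual ℂ V) (g : G) : Module.Dual ℂ V :=
  ξ ∘ₗ ρ g

/-- `ξ · (g - χ(g))`. -/
def twistedDiff (ρ : Representation ℂ G V) (χ : G →* ℂˣ) (ξ : Module.Dual ℂ V) (g : G) :
    Module.Dual ℂ V :=
  dualRightAct ρ ξ g - (χ g : ℂ) • ξ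

/-- `ξ · (g₁ - χ(g₁)) (g₂ - χ(g₂)) ⋯ (gₙ - χ(gₙ))` for the list `gs = [g₁, …, gₙ]`. -/
def twistedProd (ρ : Representation ℂ G V) (χ : G →* ℂˣ) (ξ : Module.Dual ℂ V) (gs : List G) :
    Module.Dual ℂ V :=
  gs.foldl (twistedDiff ρ χ) ξ

/-- The generalized `χ`-invariant functionals of order `≤ k`: those killed by
`(g₀ - χ(g₀)) (g₁ - χ(g₁)) ⋯ (g_k - χ(g_k))` for all `g₀, …, g_k` in `G`. -/
def genInvariantsOfOrder (ρ : Representation ℂ G V) (χ : G →* ℂˣ) (k : ℕ) :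
    Set (Module.Dual ℂ V) :=
  {ξ | ∀ gs : List G, gs.length = k + 1 → twistedProd ρ χ ξ gs = 0}

/-- The generalized `χ`-invariant functionals (of any finite order). -/
def genInvariants (ρ : Representation ℂ G V) (χ : G →* ℂˣ) : Set (Module.Dual ℂ V) :=
  ⋃ k : ℕ, genInvariantsOfOrder ρ χ k

/-- The operator `(g₁ - χ(g₁)) ⋯ (gₙ - χ(gₙ))` acts by zero on the generalized `χ`-invariant
functionals. -/
def ActsByZero (ρ : Representation ℂ G V) (χ : G →* ℂˣ) (gs : List G) : Prop :=
  ∀ ξ ∈ genInvariants ρ χ, twistedProd ρ χ ξ gs = 0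

end GeneralizedInvariants

section Schwartz

/-- The space of locally constant, compactly supported complex functions. -/
def SchwartzSpace (X : Type*) [TopologicalSpace X] : Submodule ℂ (X → ℂ) where
  carrier := {φ | IsLocallyConstant φ ∧ HasCompactSupport φ}
  add_mem' ha hb := ⟨ha.1.add hb.1, ha.2.add hb.2⟩
  zero_mem' := ⟨IsLocallyConstant.const 0, HasCompactSupport.zero⟩
  smul_mem' c _ h := ⟨h.1.comp (fun z => c • z), h.2.comp_left (g := fun z => c • z) (smul_zero c)⟩

/-- The action of `G` on the Schwartz space, `(g · φ)(x) = φ (g⁻¹ · x)`. -/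
def schwartzRep (G : Type*) [Group G] (X : Type*) [TopologicalSpace X] [MulAction G X]
    [ContinuousConstSMul G X] : Representation ℂ G (SchwartzSpace X) where
  toFun g :=
    { toFun := fun φ => ⟨fun x => φ.1 (g⁻¹ • x),
        φ.2.1.comp_continuous (continuous_const_smul g⁻¹),
        φ.2.2.comp_homeomorph (Homeomorph.smul g⁻¹)⟩
      map_add' := fun _ _ => rfl
      map_smul' := fun _ _ => rfl }
  map_one' := by ext φ x; simp
  map_mul' g h := by ext φ x; simp [mul_smul]

/-- `G` acts continuously on each orbit (with the subspace topology). -/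
instance orbit_continuousConstSMul {G X : Type*} [Group G] [TopologicalSpace X] [MulAction G X]
    [ContinuousConstSMul G X] (x : X) : ContinuousConstSMul G (MulAction.orbit G x) where
  continuous_const_smul g :=
    ((continuous_const_smul g).comp continuous_subtype_val).subtype_mk _

/-- A subset is a disjoint union of finitely many closed `G`-orbits. -/
def IsFiniteDisjointUnionOfClosedOrbits (G : Type*) {X : Type*} [Group G] [TopologicalSpace X]
    [MulAction G X] (Z : Set X) : Prop :=
  ∃ S : Set (Set X), S.Finite ∧ S.PairwiseDisjoint id ∧
    (∀ O ∈ S, IsClosed O ∧ ∃ x : X, O = MulAction.orbit G x) ∧ ⋃₀ S = Z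

end Schwartz

noncomputable section Sheaves

/-- The stalks of a sheaf of complex vector spaces are computed on underlying sets. -/
instance forgetModuleCat_preservesFilteredColimits :
    Limits.PreservesFilteredColimits (forget (ModuleCat.{u} ℂ)) :=
  haveI : Limits.PreservesFilteredColimits (forget₂ (ModuleCat.{u} ℂ) AddCommGrpCat.{u}) :=
    ⟨fun _ _ _ => inferInstance⟩
  Limits.comp_preservesFilteredColimits (forget₂ (ModuleCat.{u} ℂ) AddCommGrpCat.{u})
    (forget AddCommGrpCat.{u})

/-- An `ℓ`-sheaf: a sheaf of complex vector spaces. -/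
abbrev LSheaf (X : Type u) [TopologicalSpace X] : Type (u + 1) :=
  TopCat.Sheaf (ModuleCat.{u} ℂ) (TopCat.of X)

namespace LSheaf

variable {X : Type u} [TopologicalSpace X]

/-- The stalk at a point, a complex vector space. -/
abbrev Stalk (F : LSheaf X) (x : X) : ModuleCat.{u} ℂ :=
  TopCat.Presheaf.stalk (X := TopCat.of X) F.presheaf x

/-- The étalé space `⨿ₓ Fₓ`, with the topology for which the images of the sections
`x ↦ sₓ` are the basic open sets. -/
abbrev Etale (F : LSheaf X) : Type u :=
  TopCat.Presheaf.EtaleSpace (X := TopCat.of X) F.presheaf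

/-- The point of the étalé space given by `v ∈ Fₓ`. -/
abbrev toEtale (F : LSheaf X) (x : X) (v : F.Stalk x) : F.Etale :=
  ⟨x, v⟩

theorem continuous_toEtale_iff (F : LSheaf X) {Z : Type*} [TopologicalSpace Z] (i : C(Z, X))
    (s : (z : Z) → F.Stalk (i z)) :
    Continuous (fun z => F.toEtale (i z) (s z)) ↔
      ∀ z : Z, ∃ (U : Opens (TopCat.of X)) (f : F.presheaf.obj (op U)),
        ∀ᶠ z' in 𝓝 z, ∃ h : i z' ∈ U, s z' = F.presheaf.germ U (i z') h f := by
  constructor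
  · intro hs z
    obtain ⟨U, -, f, hf⟩ := TopCat.Presheaf.EtaleSpace.exists_section_of_tendsto (hs.tendsto z)
    exact ⟨U, f, hf⟩
  · intro hs
    refine continuous_generateFrom_iff.2 ?_
    rintro _ ⟨V, f, rfl⟩
    refine isOpen_iff_mem_nhds.2 fun z hz => ?_
    obtain ⟨hzV, hzf⟩ := hz
    obtain ⟨U, f', hU⟩ := hs z
    obtain ⟨hzU, hzf'⟩ := hU.self_of_nhds
    obtain ⟨W, hzW, iWU, iWV, hW⟩ := F.presheaf.germ_eq (i z) hzU hzV f' f (hzf'.symm.trans hzf)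
    have hWn : ∀ᶠ z' in 𝓝 z, i z' ∈ W :=
      i.continuous.continuousAt.eventually (W.isOpen.mem_nhds hzW)
    filter_upwards [hU, hWn] with z' h1 h2
    obtain ⟨h1U, h1⟩ := h1
    refine ⟨iWV.le h2, ?_⟩
    change s z' = _
    rw [h1, ← F.presheaf.germ_res_apply iWU (i z') h2, hW, F.presheaf.germ_res_apply]

/-- For a continuous map `i : Z → X` (the identity of `X` or the inclusion of a subset), the space
`Γ_c(Z, F|_Z)` of compactly supported continuous sections over `Z` of the étalé space of `F`. -/
def GammaC (F : LSheaf X) {Z : Type*} [TopologicalSpace Z] (i : C(Z, X)) :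
    Submodule ℂ ((z : Z) → F.Stalk (i z)) where
  carrier := {s | Continuous (fun z => F.toEtale (i z) (s z)) ∧ IsCompact (closure {z | s z ≠ 0})}
  add_mem' := by
    rintro s t ⟨hs, hsc⟩ ⟨ht, htc⟩
    refine ⟨?_, ?_⟩
    · rw [continuous_toEtale_iff] at hs ht ⊢
      intro z
      obtain ⟨U, f, hf⟩ := hs z
      obtain ⟨V, g, hg⟩ := ht z
      refine ⟨U ⊓ V, F.presheaf.map (homOfLE inf_le_left).op f +
        F.presheaf.map (homOfLE inf_le_right).op g, ?_⟩
      filter_upwards [hf, hg] with z' h1 h2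
      obtain ⟨h1U, h1⟩ := h1
      obtain ⟨h2V, h2⟩ := h2
      refine ⟨⟨h1U, h2V⟩, ?_⟩
      have e1 := F.presheaf.germ_res_apply (homOfLE (inf_le_left : U ⊓ V ≤ U)) (i z')
        ⟨h1U, h2V⟩ f
      have e2 := F.presheaf.germ_res_apply (homOfLE (inf_le_right : U ⊓ V ≤ V)) (i z')
        ⟨h1U, h2V⟩ g
      exact ((map_add _ _ _).trans (congrArg₂ (· + ·) (e1.trans h1.symm) (e2.trans h2.symm))).symm
    · refine (hsc.union htc).of_isClosed_subset isClosed_closure ?_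
      rw [← closure_union]
      refine closure_mono fun z hz => ?_
      by_contra h
      simp only [Set.mem_union, Set.mem_ofPred_eq, not_or, not_not] at h
      exact hz (by simp [h.1, h.2])
  zero_mem' := by
    refine ⟨?_, by simp⟩
    rw [continuous_toEtale_iff]
    intro z
    refine ⟨⊤, 0, Filter.Eventually.of_forall fun z' => ⟨trivial, ?_⟩⟩
    rw [map_zero]
    rfl
  smul_mem' := by
    rintro c s ⟨hs, hsc⟩
    refine ⟨?_, ?_⟩
    · rw [continuous_toEtale_iff] at hs ⊢
      intro z
      obtain ⟨U, f, hf⟩ := hs z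
      refine ⟨U, c • f, ?_⟩
      filter_upwards [hf] with z' h1
      obtain ⟨h1U, h1⟩ := h1
      refine ⟨h1U, ?_⟩
      rw [map_smul, ← h1]
      rfl
    · refine hsc.of_isClosed_subset isClosed_closure (closure_mono fun z hz h => hz ?_)
      simp [h]

end LSheaf

/-- A `G`-equivariant `ℓ`-sheaf on `X`: an `ℓ`-sheaf with a continuous action of `G` on its étalé
space such that each `g` restricts to linear maps `Fₓ → F_{g x}`.  The map `act g x y h` is
the action of `g` from `Fₓ` to `F_y` where `h : g • x = y`. -/
structure EquivariantLSheaf (G : Type*) [Group G] [TopologicalSpace G]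
    (X : Type u) [TopologicalSpace X] [MulAction G X] where
  sheaf : LSheaf X
  act : ∀ (g : G) (x y : X), g • x = y → (sheaf.Stalk x →ₗ[ℂ] sheaf.Stalk y)
  act_one : ∀ (x : X) (v : sheaf.Stalk x), act 1 x x (one_smul G x) v = v
  act_mul : ∀ (g h : G) (x y z : X) (hxy : h • x = y) (hyz : g • y = z) (v : sheaf.Stalk x),
    act (g * h) x z (by rw [mul_smul, hxy, hyz]) v = act g y z hyz (act h x y hxy v)
  continuous_act : Continuous fun p : G × sheaf.Etale =>
    sheaf.toEtale (p.1 • (p.2.base : X)) (act p.1 p.2.base (p.1 • (p.2.base : X)) rfl p.2.germ)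

namespace EquivariantLSheaf

variable {G : Type*} [Group G] [TopologicalSpace G] {X : Type u} [TopologicalSpace X]
  [MulAction G X]

theorem toEtale_act_congr (F : EquivariantLSheaf G X) (g : G) (x y : X) (h : g • x = y)
    (v : F.sheaf.Stalk x) :
    F.sheaf.toEtale y (F.act g x y h v) = F.sheaf.toEtale (g • x) (F.act g x (g • x) rfl v) := by
  subst h; rfl

theorem act_eq_one (F : EquivariantLSheaf G X) {Z : Type*} (i : Z → X) (g : G) (hg : g = 1)
    (s : (z : Z) → F.sheaf.Stalk (i z)) (z w : Z) (hw : w = z) (h : g • i w = i z) :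
    F.act g (i w) (i z) h (s w) = s z := by
  subst hg; subst hw; exact F.act_one _ _

theorem act_congr_point (F : EquivariantLSheaf G X) {Z : Type*} (i : Z → X) (g : G)
    (s : (z : Z) → F.sheaf.Stalk (i z)) (w w' : Z) (y : X) (hw : w = w') (h : g • i w = y)
    (h' : g • i w' = y) :
    F.act g (i w) y h (s w) = F.act g (i w') y h' (s w') := by
  subst hw; rfl

/-- For an equivariant continuous map `i : Z → X`, the action of `G` on `Γ_c(Z, F|_Z)`,
`(g · s)_z = g · s_{g⁻¹ z}`. -/
def gammaRep (F : EquivariantLSheaf G X) {Z : Type*} [TopologicalSpace Z] [MulAction G Z]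
    [ContinuousConstSMul G Z] (i : C(Z, X)) (hi : ∀ (g : G) (z : Z), i (g • z) = g • i z) :
    Representation ℂ G (F.sheaf.GammaC i) where
  toFun g :=
    { toFun := fun s =>
        ⟨fun z => F.act g (i (g⁻¹ • z)) (i z) (by rw [← hi, smul_inv_smul]) (s.1 (g⁻¹ • z)), by
          constructor
          · have h1 : Continuous fun z : Z =>
                ((g, F.sheaf.toEtale (i (g⁻¹ • z)) (s.1 (g⁻¹ • z))) : G × F.sheaf.Etale) :=
              continuous_const.prodMk (s.2.1.comp (continuous_const_smul g⁻¹))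
            refine (F.continuous_act.comp h1).congr fun z => ?_
            exact (F.toEtale_act_congr g _ _ _ _).symm
          · refine (s.2.2.image (continuous_const_smul g)).of_isClosed_subset
              isClosed_closure ?_
            have h2 : (fun z : Z => g • z) '' closure {z | s.1 z ≠ 0} =
                closure ((fun z : Z => g • z) '' {z | s.1 z ≠ 0}) :=
              (Homeomorph.smul g).image_closure _
            rw [h2]
            refine closure_mono fun z hz => ⟨g⁻¹ • z, fun h => hz ?_, smul_inv_smul g z⟩
            dsimp only
            rw [h, map_zero]⟩
      map_add' := fun s t => Subtype.ext (funext fun z => map_add _ _ _)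
      map_smul' := fun c s => Subtype.ext (funext fun z => map_smul _ _ _) }
  map_one' := by
    refine LinearMap.ext fun s => Subtype.ext (funext fun z => ?_)
    exact F.act_eq_one i 1 rfl s.1 z _ (by simp) _
  map_mul' g h := by
    refine LinearMap.ext fun s => Subtype.ext (funext fun z => ?_)
    have e : (g * h)⁻¹ • z = h⁻¹ • g⁻¹ • z := by rw [mul_inv_rev, mul_smul]
    refine (F.act_congr_point i (g * h) s.1 _ _ (i z) e _ ?_).trans (F.act_mul g h _ _ _ ?_ ?_ _)
    · rw [← hi, mul_smul, smul_inv_smul, smul_inv_smul]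
    · rw [← hi, smul_inv_smul]
    · rw [← hi, smul_inv_smul]

/-- The `G`-representation `Γ_c(X, F)`; its dual is the space of distributions on `F`. -/
def globalRep [ContinuousConstSMul G X] (F : EquivariantLSheaf G X) :
    Representation ℂ G (F.sheaf.GammaC (ContinuousMap.id X)) :=
  F.gammaRep (ContinuousMap.id X) fun _ _ => rfl

/-- The `G`-representation `Γ_c(Z, F|_Z)` for a `G`-stable subset `Z` of `X` with the subspace
topology; its dual is the space of distributions on `F|_Z`. -/
def restrictRep [ContinuousConstSMul G X] (F : EquivariantLSheaf G X) (Z : SubMulAction G X) :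
    haveI : ContinuousConstSMul G Z := IsInducing.subtypeVal.continuousConstSMul id rfl
    Representation ℂ G (F.sheaf.GammaC (⟨Subtype.val, continuous_subtype_val⟩ : C(Z, X))) :=
  haveI : ContinuousConstSMul G Z := IsInducing.subtypeVal.continuousConstSMul id rfl
  F.gammaRep _ fun _ _ => rfl

end EquivariantLSheaf

end Sheaves

/-- The fiber `π⁻¹(y)` of a `G`-invariant map, as a `G`-stable subset. -/
def invariantFiber {G X Y : Type*} [Group G] [MulAction G X] (π : X → Y)
    (hπ : ∀ (g : G) (x : X), π (g • x) = π x) (y : Y) : SubMulAction G X where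
  carrier := π ⁻¹' {y}
  smul_mem' g x hx := (hπ g x).trans hx

/-! ### Passing from functionals to subspaces of the representation -/

section TwistedOperators

variable {G : Type*} [Group G] {V : Type*} [AddCommGroup V] [Module ℂ V]
  {V' : Type*} [AddCommGroup V'] [Module ℂ V']

/-! Dualise. A functional is generalized `χ`-invariant of order `≤ k` exactly when it kills the
subspace `twistedSpan ρ χ k`, and functionals separate a subspace from any vector outside it. So the
product of the `gᵢ - χ(gᵢ)` acts by zero on the generalized invariants iff it maps the
representation into `twistedSpan ρ χ k` for every `k` (`actsByZero_iff`). The problem becomes one of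
membership in a subspace of compactly supported sections.

Such membership is local on `Y`. Let `w` be in the image of the product. On the fiber over `y` its
restriction lies in the corresponding span by hypothesis. Restriction to a fiber is surjective and
equivariant, so the restriction lifts to some `u` in the span upstairs. Now `w - u` vanishes on the
fiber and has compact support, hence vanishes over a clopen neighbourhood `U` of `y`. Cutting off
along the preimage of `U` commutes with `G` because `π` is invariant, so it preserves the span, and
the cutoff of `w`, being that of `u`, lies in it. Compactness of the image of the support of `w`
finishes the argument (`actsByZero_of_fibers`).

Part (1) is this principle for sections of a sheaf. Part (2) uses it twice for functions: along `π`,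
and then on each fiber along the map to its finite discrete set of orbits. -/

/-- The operator `(g₁ - χ(g₁)) ⋯ (gₙ - χ(gₙ))` on a representation. -/
def twistedOp (ρ : Representation ℂ G V) (χ : G →* ℂˣ) (gs : List G) : Module.End ℂ V :=
  (gs.map fun g => ρ g - (χ g : ℂ) • (1 : Module.End ℂ V)).prod

theorem twistedOp_cons (ρ : Representation ℂ G V) (χ : G →* ℂˣ) (g : G) (gs : List G) (v : V) :
    twistedOp ρ χ (g :: gs) v = ρ g (twistedOp ρ χ gs v) - (χ g : ℂ) • twistedOp ρ χ gs v := by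
  simp [twistedOp]

/-- The fold applies the head of the list to `ξ` first, and in the operator product the head is the
leftmost factor, so the two orders agree. -/
theorem twistedProd_apply (ρ : Representation ℂ G V) (χ : G →* ℂˣ) (gs : List G)
    (ξ : Module.Dual ℂ V) (v : V) : twistedProd ρ χ ξ gs v = ξ (twistedOp ρ χ gs v) := by
  induction gs generalizing ξ with
  | nil => simp [twistedProd, twistedOp]
  | cons g gs ih =>
    refine (ih (twistedDiff ρ χ ξ g)).trans ?_
    simp [twistedDiff, dualRightAct, twistedOp_cons]

/-- The span of the images of all operators `(g₀ - χ(g₀)) ⋯ (g_k - χ(g_k))`. -/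
def twistedSpan (ρ : Representation ℂ G V) (χ : G →* ℂˣ) (k : ℕ) : Submodule ℂ V :=
  Submodule.span ℂ {w | ∃ gs : List G, gs.length = k + 1 ∧ ∃ v, twistedOp ρ χ gs v = w}

theorem mem_genInvariantsOfOrder_iff (ρ : Representation ℂ G V) (χ : G →* ℂˣ) (k : ℕ)
    (ξ : Module.Dual ℂ V) :
    ξ ∈ genInvariantsOfOrder ρ χ k ↔ twistedSpan ρ χ k ≤ LinearMap.ker ξ := by
  rw [twistedSpan, Submodule.span_le]
  constructor
  · rintro h _ ⟨gs, hgs, v, rfl⟩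
    simpa [twistedProd_apply] using LinearMap.congr_fun (h gs hgs) v
  · intro h gs hgs
    ext v
    rw [twistedProd_apply]
    exact h ⟨gs, hgs, v, rfl⟩

/-- Over a field, a vector outside a subspace is detected by a functional vanishing on that
subspace; here such a functional is a generalized invariant. -/
theorem actsByZero_iff (ρ : Representation ℂ G V) (χ : G →* ℂˣ) (gs : List G) :
    ActsByZero ρ χ gs ↔ ∀ k v, twistedOp ρ χ gs v ∈ twistedSpan ρ χ k := by
  constructor
  · intro h k v
    by_contra hv
    obtain ⟨ξ, hξv, hξ⟩ := Submodule.exists_le_ker_of_notMem hv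
    refine hξv ?_
    have := h ξ (Set.mem_iUnion.2 ⟨k, (mem_genInvariantsOfOrder_iff ρ χ k ξ).2 hξ⟩)
    rw [← twistedProd_apply, this]
    rfl
  · intro h ξ hξ
    obtain ⟨k, hk⟩ := Set.mem_iUnion.1 hξ
    ext v
    rw [twistedProd_apply]
    exact (mem_genInvariantsOfOrder_iff ρ χ k ξ).1 hk (h k v)

variable {ρ : Representation ℂ G V} {ρ' : Representation ℂ G V'} {r : V →ₗ[ℂ] V'}

theorem map_twistedOp (hr : ∀ g v, r (ρ g v) = ρ' g (r v)) (χ : G →* ℂˣ) (gs : List G) (v : V) :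
    r (twistedOp ρ χ gs v) = twistedOp ρ' χ gs (r v) := by
  induction gs with
  | nil => simp [twistedOp]
  | cons g gs ih => simp [twistedOp_cons, hr, ih]

theorem map_mem_twistedSpan (hr : ∀ g v, r (ρ g v) = ρ' g (r v)) (χ : G →* ℂˣ) (k : ℕ) {v : V}
    (hv : v ∈ twistedSpan ρ χ k) : r v ∈ twistedSpan ρ' χ k := by
  revert v
  change twistedSpan ρ χ k ≤ (twistedSpan ρ' χ k).comap r
  refine Submodule.span_le.2 ?_
  rintro _ ⟨gs, hgs, v, rfl⟩
  exact Submodule.subset_span ⟨gs, hgs, r v, (map_twistedOp hr χ gs v).symm⟩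

/-- A generator downstairs is an operator applied to some `r v`, and the same operator applied to
`v` is a generator upstairs lying over it. -/
theorem exists_mem_twistedSpan_lift (hr : ∀ g v, r (ρ g v) = ρ' g (r v))
    (hs : Function.Surjective r) (χ : G →* ℂˣ) (k : ℕ) {w : V'} (hw : w ∈ twistedSpan ρ' χ k) :
    ∃ v ∈ twistedSpan ρ χ k, r v = w := by
  revert w
  change twistedSpan ρ' χ k ≤ (twistedSpan ρ χ k).map r
  refine Submodule.span_le.2 ?_
  rintro _ ⟨gs, hgs, v', rfl⟩
  obtain ⟨v, rfl⟩ := hs v'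
  exact ⟨twistedOp ρ χ gs v, Submodule.subset_span ⟨gs, hgs, v, rfl⟩, map_twistedOp hr χ gs v⟩

end TwistedOperators

/-! ### Localization over a totally disconnected base -/

section Localization

theorem exists_isClopen_subset {X : Type*} [TopologicalSpace X] [T2Space X] [LocallyCompactSpace X]
    [TotallyDisconnectedSpace X] {x : X} {N : Set X} (hN : N ∈ 𝓝 x) :
    ∃ U : Set X, IsClopen U ∧ IsCompact U ∧ x ∈ U ∧ U ⊆ N := by
  obtain ⟨K, hK, hKN, hKc⟩ := local_compact_nhds hN
  obtain ⟨U, hU, hxU, hUK⟩ :=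
    (loc_compact_Haus_tot_disc_of_zero_dim (H := X)).mem_nhds_iff.1 hK
  exact ⟨U, hU, hKc.of_isClosed_subset hU.1 hUK, hxU, hUK.trans hKN⟩

/-- **Localization principle.** A representation `V` carrying commuting cutoffs along the clopen
subsets of `Y` satisfies `ActsByZero` as soon as all its fibers `V' y` do. -/
theorem actsByZero_of_fibers {G : Type*} [Group G] {V : Type*} [AddCommGroup V] [Module ℂ V]
    {Y : Type*} [TopologicalSpace Y] {V' : Y → Type*} [∀ y, AddCommGroup (V' y)]
    [∀ y, Module ℂ (V' y)] (ρ : Representation ℂ G V) (ρ' : ∀ y, Representation ℂ G (V' y))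
    (r : ∀ y, V →ₗ[ℂ] V' y) (hr : ∀ y g v, r y (ρ g v) = ρ' y g (r y v))
    (hrs : ∀ y, Function.Surjective (r y))
    (e : Clopens Y → V →ₗ[ℂ] V) (he : ∀ U g v, e U (ρ g v) = ρ g (e U v))
    (he_bot : ∀ v, e ⊥ v = 0)
    (he_sup : ∀ U U' v, e (U ⊔ U') v = e U v + e U' v - e U (e U' v))
    (he_ker : ∀ y v, r y v = 0 → ∃ U : Clopens Y, y ∈ U ∧ e U v = 0)
    (he_supp : ∀ v, ∃ K : Set Y, IsCompact K ∧ ∀ U : Clopens Y, K ⊆ U → e U v = v)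
    (χ : G →* ℂˣ) (gs : List G) (h : ∀ y, ActsByZero (ρ' y) χ gs) : ActsByZero ρ χ gs := by
  rw [actsByZero_iff]
  intro k v
  set w := twistedOp ρ χ gs v with hw
  obtain ⟨K, hK, hKw⟩ := he_supp w
  have key : ∃ U : Clopens Y, K ⊆ U ∧ e U w ∈ twistedSpan ρ χ k := by
    refine hK.induction_on (p := fun K => ∃ U : Clopens Y, K ⊆ U ∧ e U w ∈ twistedSpan ρ χ k)
      ?_ ?_ ?_ ?_
    · exact ⟨⊥, by simp, by simp [he_bot]⟩
    · exact fun _ _ hst ht => ht.imp fun U hU => ⟨hst.trans hU.1, hU.2⟩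
    · rintro _ _ ⟨U, hU, hUw⟩ ⟨U', hU', hUw'⟩
      refine ⟨U ⊔ U', Set.union_subset_union hU hU', ?_⟩
      -- Inclusion–exclusion: each of the three terms is in the span, since a cutoff is a
      -- self-intertwiner and preserves it.
      rw [he_sup]
      exact sub_mem (add_mem hUw hUw') (map_mem_twistedSpan (he U) χ k hUw')
    · intro y _
      have hy : r y w ∈ twistedSpan (ρ' y) χ k := by
        rw [hw, map_twistedOp (hr y)]
        exact (actsByZero_iff _ _ _).1 (h y) k _
      -- The lift `u` need not be related to `w` away from `y`; only their agreement near the fiber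
      -- matters.
      obtain ⟨u, hu, huw⟩ := exists_mem_twistedSpan_lift (hr y) (hrs y) χ k hy
      obtain ⟨U, hyU, hU⟩ := he_ker y (w - u) (by rw [map_sub, huw, sub_self])
      refine ⟨U, mem_nhdsWithin_of_mem_nhds (U.isClopen.isOpen.mem_nhds hyU), U, subset_rfl, ?_⟩
      rw [map_sub, sub_eq_zero] at hU
      rw [hU]
      exact map_mem_twistedSpan (he U) χ k hu
  obtain ⟨U, hU, hUw⟩ := key
  rwa [hKw U hU] at hUw

variable {X : Type*} [TopologicalSpace X] {E : X → Type*} [∀ x, AddCommGroup (E x)]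
  [∀ x, Module ℂ (E x)]

/-- A space of sections is local if it is stable under cutoff to clopen subsets and all its members
have compact support. -/
structure IsLocalSections (Γ : Submodule ℂ (∀ x, E x)) : Prop where
  indicator : ∀ U : Set X, IsClopen U → ∀ s ∈ Γ, (open Classical in U.piecewise s 0) ∈ Γ
  isCompact_support : ∀ s ∈ Γ, IsCompact {x | s x ≠ 0}

open Classical in
/-- Sections defined locally on a subspace, with compact support, extend. -/
theorem IsLocalSections.exists_extension [T2Space X] [LocallyCompactSpace X]
    [TotallyDisconnectedSpace X] {Γ : Submodule ℂ (∀ x, E x)} (hΓ : IsLocalSections Γ)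
    {Z : Type*} [TopologicalSpace Z] {j : Z → X} (hj : IsInducing j) (s : ∀ z, E (j z))
    (hs : IsCompact {z | s z ≠ 0})
    (hloc : ∀ z, ∃ t ∈ Γ, ∀ᶠ z' in 𝓝 z, t (j z') = s z') : ∃ t ∈ Γ, ∀ z, t (j z) = s z := by
  have key : ∃ t ∈ Γ, ∃ W : Set X, IsClopen W ∧ (∀ z, s z ≠ 0 → j z ∈ W) ∧
      ∀ z, j z ∈ W → t (j z) = s z := by
    -- Agreement is required on all of `j ⁻¹' W`, not only on `K`, so that two local extensions can
    -- be glued along clopen sets of `X`.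
    refine hs.induction_on (p := fun K => ∃ t ∈ Γ, ∃ W : Set X, IsClopen W ∧ K ⊆ j ⁻¹' W ∧
      ∀ z, j z ∈ W → t (j z) = s z) ?_ ?_ ?_ ?_
    · exact ⟨0, zero_mem _, ∅, isClopen_empty, by simp, by simp⟩
    · rintro _ _ hst ⟨t, ht, W, hW, hKW, h⟩
      exact ⟨t, ht, W, hW, hst.trans hKW, h⟩
    · rintro _ _ ⟨t, ht, W, hW, hKW, h⟩ ⟨t', ht', W', hW', hKW', h'⟩
      -- Make the pieces disjoint: `t` on `W`, `t'` on the complement of `W`.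
      refine ⟨_, add_mem (hΓ.indicator W hW t ht) (hΓ.indicator (Wᶜ) hW.compl t' ht'), W ∪ W',
        hW.union hW', Set.union_subset_union hKW hKW', fun z hz => ?_⟩
      by_cases hzW : j z ∈ W
      · simp [Set.piecewise, hzW, h z hzW]
      · simp [Set.piecewise, hzW, h' z (hz.resolve_left hzW)]
    · intro z _
      obtain ⟨t, ht, hz⟩ := hloc z
      rw [hj.nhds_eq_comap] at hz
      obtain ⟨N, hN, hNz⟩ := hz
      obtain ⟨W, hW, -, hzW, hWN⟩ := exists_isClopen_subset hN
      exact ⟨j ⁻¹' W, mem_nhdsWithin_of_mem_nhds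
        ((hW.isOpen.preimage hj.continuous).mem_nhds hzW), t, ht, W, hW, subset_rfl,
        fun z' hz' => hNz (hWN hz')⟩
  obtain ⟨t, ht, W, hW, hsW, h⟩ := key
  -- Outside `W` the section `s` is zero while `t` is uncontrolled, so `t` is cut off to `W`.
  refine ⟨_, hΓ.indicator W hW t ht, fun z => ?_⟩
  by_cases hz : j z ∈ W
  · simp [Set.piecewise, hz, h z hz]
  · simp only [Set.piecewise, hz, if_false, Pi.zero_apply]
    by_contra h0
    exact hz (hsW z (Ne.symm h0))

open Classical in
/-- Cutoff of sections along a clopen set. -/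
noncomputable def IsLocalSections.cutoff {Γ : Submodule ℂ (∀ x, E x)} (hΓ : IsLocalSections Γ)
    (U : Set X) (hU : IsClopen U) : Γ →ₗ[ℂ] Γ where
  toFun s := ⟨U.piecewise s.1 0, hΓ.indicator U hU s.1 s.2⟩
  map_add' s t := by
    ext x
    by_cases hx : x ∈ U <;> simp [Set.piecewise, hx]
  map_smul' c s := by
    ext x
    by_cases hx : x ∈ U <;> simp [Set.piecewise, hx]

theorem IsLocalSections.cutoff_of_mem {Γ : Submodule ℂ (∀ x, E x)} (hΓ : IsLocalSections Γ)
    {U : Set X} (hU : IsClopen U) (s : Γ) {x : X} (hx : x ∈ U) :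
    (hΓ.cutoff U hU s).1 x = s.1 x := by
  simp [cutoff, hx]

theorem IsLocalSections.cutoff_of_notMem {Γ : Submodule ℂ (∀ x, E x)} (hΓ : IsLocalSections Γ)
    {U : Set X} (hU : IsClopen U) (s : Γ) {x : X} (hx : x ∉ U) :
    (hΓ.cutoff U hU s).1 x = 0 := by
  simp [cutoff, hx]

/-- The localization principle for spaces of sections over `X`, along an invariant map `X → Y`. -/
theorem IsLocalSections.actsByZero {Γ : Submodule ℂ (∀ x, E x)} (hΓ : IsLocalSections Γ)
    {G : Type*} [Group G] {Y : Type*} [TopologicalSpace Y] [T2Space Y] [LocallyCompactSpace Y]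
    [TotallyDisconnectedSpace Y] {π : X → Y} (hπ : Continuous π) (ρ : Representation ℂ G Γ)
    (hρ : ∀ (U : Set X) (hU : IsClopen U), (∃ A, U = π ⁻¹' A) →
      ∀ g s, hΓ.cutoff U hU (ρ g s) = ρ g (hΓ.cutoff U hU s))
    {V' : Y → Type*} [∀ y, AddCommGroup (V' y)] [∀ y, Module ℂ (V' y)]
    (ρ' : ∀ y, Representation ℂ G (V' y)) (r : ∀ y, Γ →ₗ[ℂ] V' y)
    (hr : ∀ y g v, r y (ρ g v) = ρ' y g (r y v)) (hrs : ∀ y, Function.Surjective (r y))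
    (hrk : ∀ y s, r y s = 0 → ∀ x, π x = y → s.1 x = 0)
    (χ : G →* ℂˣ) (gs : List G) (h : ∀ y, ActsByZero (ρ' y) χ gs) : ActsByZero ρ χ gs := by
  refine actsByZero_of_fibers ρ ρ' r hr hrs
    (fun U => hΓ.cutoff (π ⁻¹' U) (U.isClopen.preimage hπ))
    (fun U => hρ _ _ ⟨U, rfl⟩) ?_ ?_ ?_ ?_ χ gs h
  · intro s
    ext x
    exact hΓ.cutoff_of_notMem _ s (by simp)
  · intro U U' s
    ext x
    change _ = (hΓ.cutoff _ _ s).1 x + (hΓ.cutoff _ _ s).1 x -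
      (hΓ.cutoff _ _ (hΓ.cutoff _ _ s)).1 x
    by_cases hx : x ∈ π ⁻¹' U
    · rw [hΓ.cutoff_of_mem _ _ hx, hΓ.cutoff_of_mem _ _ hx, hΓ.cutoff_of_mem _ _ (Or.inl hx)]
      abel
    · rw [hΓ.cutoff_of_notMem _ _ hx, hΓ.cutoff_of_notMem _ _ hx, zero_add, sub_zero]
      by_cases hx' : x ∈ π ⁻¹' U'
      · rw [hΓ.cutoff_of_mem _ _ hx', hΓ.cutoff_of_mem _ _ (Or.inr hx')]
      · rw [hΓ.cutoff_of_notMem _ _ hx', hΓ.cutoff_of_notMem _ _ (fun h => h.elim hx hx')]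
  · intro y s hs
    have hK := (hΓ.isCompact_support s.1 s.2).image hπ
    -- The image of the support is compact, hence closed, and misses `y` because `s` vanishes on the
    -- fiber.
    obtain ⟨U, hU, -, hyU, hUK⟩ := exists_isClopen_subset (hK.isClosed.isOpen_compl.mem_nhds
      (x := y) (by rintro ⟨x, hx, rfl⟩; exact hx (hrk _ s hs x rfl)))
    refine ⟨⟨U, hU⟩, hyU, ?_⟩
    ext x
    by_cases hx : π x ∈ U
    · rw [hΓ.cutoff_of_mem _ _ hx]
      by_contra h0
      exact hUK hx ⟨x, h0, rfl⟩
    · exact hΓ.cutoff_of_notMem _ _ hx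
  · intro s
    refine ⟨_, (hΓ.isCompact_support s.1 s.2).image hπ, fun U hU => ?_⟩
    ext x
    by_cases hx : π x ∈ U
    · exact hΓ.cutoff_of_mem _ _ hx
    · rw [hΓ.cutoff_of_notMem _ _ hx]
      by_contra h0
      exact hx (hU ⟨x, Ne.symm h0, rfl⟩)

end Localization
-- Locally constant functions and closed orbits
section Schwartz

variable {X : Type*} [TopologicalSpace X]

theorem isLocalSections_schwartzSpace (X : Type*) [TopologicalSpace X] :
    IsLocalSections (E := fun _ : X => ℂ) (SchwartzSpace X) where
  indicator U hU φ hφ := by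
    classical
    refine ⟨(IsLocallyConstant.iff_eventually_eq _).2 fun x => ?_, ?_⟩
    · have h := (IsLocallyConstant.iff_eventually_eq φ).1 hφ.1 x
      by_cases hx : x ∈ U
      · filter_upwards [h, hU.isOpen.mem_nhds hx] with y hy hyU
        simp [hx, hyU, hy]
      · filter_upwards [hU.compl.isOpen.mem_nhds hx] with y hy
        simp [hx, show y ∉ U from hy]
    · refine hφ.2.of_isClosed_subset isClosed_closure (closure_mono fun x hx h => hx ?_)
      simp [Set.piecewise, h]
  isCompact_support φ hφ :=
    hφ.2.of_isClosed_subset (hφ.1.isOpen_fiber 0).isClosed_compl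
      subset_closure

variable {Z : Type*} [TopologicalSpace Z]

/-- Restriction of Schwartz functions along a closed embedding. -/
def schwartzRestrict {j : Z → X} (hj : IsClosedEmbedding j) :
    SchwartzSpace X →ₗ[ℂ] SchwartzSpace Z where
  toFun φ := ⟨φ.1 ∘ j, φ.2.1.comp_continuous hj.continuous, φ.2.2.comp_isClosedEmbedding hj⟩
  map_add' _ _ := rfl
  map_smul' _ _ := rfl

theorem schwartzRestrict_surjective [T2Space X] [LocallyCompactSpace X]
    [TotallyDisconnectedSpace X] {j : Z → X} (hj : IsClosedEmbedding j) :
    Function.Surjective (schwartzRestrict hj) := by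
  classical
  intro φ
  have hloc : ∀ z, ∃ t ∈ SchwartzSpace X, ∀ᶠ z' in 𝓝 z, t (j z') = φ.1 z' := fun z => ?_
  · obtain ⟨t, ht, h⟩ := (isLocalSections_schwartzSpace X).exists_extension hj.isInducing φ.1
      ((isLocalSections_schwartzSpace Z).isCompact_support φ.1 φ.2) hloc
    exact ⟨⟨t, ht⟩, Subtype.ext (funext h)⟩
  -- Near `z` the function is constant, so that constant on a compact clopen neighbourhood of `j z`
  -- is a local extension.
  · obtain ⟨K, hK, hKc, hzK, -⟩ := exists_isClopen_subset (Filter.univ_mem (f := 𝓝 (j z)))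
    refine ⟨K.indicator fun _ => φ.1 z, ⟨?_, ?_⟩, ?_⟩
    · exact ((LocallyConstant.const X (φ.1 z)).indicator hK).isLocallyConstant
    · exact HasCompactSupport.intro hKc fun x hx => by simp [hx]
    · filter_upwards [(IsLocallyConstant.iff_eventually_eq φ.1).1 φ.2.1 z,
        (hK.isOpen.preimage hj.continuous).mem_nhds hzK] with z' h1 h2
      rw [h1, Set.indicator_of_mem (show j z' ∈ K from h2)]

/-- The localization principle for Schwartz functions. -/
theorem actsByZero_schwartzRep_of_fibers {G : Type*} [Group G] [T2Space X] [LocallyCompactSpace X]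
    [TotallyDisconnectedSpace X] [MulAction G X] [ContinuousConstSMul G X] {Y : Type*}
    [TopologicalSpace Y] [T2Space Y] [LocallyCompactSpace Y] [TotallyDisconnectedSpace Y]
    {π : X → Y} (hπc : Continuous π) (hπ : ∀ (g : G) (x : X), π (g • x) = π x)
    {Z : Y → Type*} [∀ y, TopologicalSpace (Z y)] [∀ y, MulAction G (Z y)]
    [∀ y, ContinuousConstSMul G (Z y)] (j : ∀ y, Z y → X) (hj : ∀ y, IsClosedEmbedding (j y))
    (hjG : ∀ y (g : G) z, j y (g • z) = g • j y z) (hjπ : ∀ y x, π x = y → x ∈ Set.range (j y))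
    (χ : G →* ℂˣ) (gs : List G) (h : ∀ y, ActsByZero (schwartzRep G (Z y)) χ gs) :
    ActsByZero (schwartzRep G X) χ gs := by
  refine (isLocalSections_schwartzSpace X).actsByZero hπc (schwartzRep G X) ?_
    (fun y => schwartzRep G (Z y)) (fun y => schwartzRestrict (hj y)) ?_
    (fun y => schwartzRestrict_surjective (hj y)) ?_ χ gs h
  · rintro U hU ⟨A, rfl⟩ g φ
    ext x
    change _ = ((isLocalSections_schwartzSpace X).cutoff _ hU φ).1 (g⁻¹ • x)
    by_cases hx : x ∈ π ⁻¹' A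
    · rw [IsLocalSections.cutoff_of_mem _ _ _ hx,
        IsLocalSections.cutoff_of_mem _ _ _ (show g⁻¹ • x ∈ π ⁻¹' A by rwa [Set.mem_preimage, hπ])]
      rfl
    · rw [IsLocalSections.cutoff_of_notMem _ _ _ hx,
        IsLocalSections.cutoff_of_notMem _ _ _ (show g⁻¹ • x ∉ π ⁻¹' A by rwa [Set.mem_preimage, hπ])]
  · intro y g φ
    ext z
    exact congrArg φ.1 (hjG y g⁻¹ z).symm
  · rintro y φ hφ x hx
    obtain ⟨z, rfl⟩ := hjπ y x hx
    exact congrFun (congrArg Subtype.val hφ) z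

/-- Finitely many disjoint closed orbits are each clopen in their union `Z`. Hence sending a point
to its orbit is a continuous invariant map to a finite discrete space, whose fibers are the orbits.
-/
theorem actsByZero_schwartzRep_of_orbits {G : Type*} [Group G] [T2Space X]
    [LocallyCompactSpace X] [TotallyDisconnectedSpace X] [MulAction G X] [ContinuousConstSMul G X]
    (χ : G →* ℂˣ) (gs : List G) (Z : SubMulAction G X)
    [ContinuousConstSMul G Z]
    (hZ : IsFiniteDisjointUnionOfClosedOrbits G (Z : Set X))
    (h : ∀ x : X, ActsByZero (schwartzRep G (MulAction.orbit G x)) χ gs) :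
    ActsByZero (schwartzRep G Z) χ gs := by
  obtain ⟨S, hSf, hSd, hSo, hSZ⟩ := hZ
  have hZc : IsClosed (Z : Set X) := by
    rw [← hSZ, Set.sUnion_eq_biUnion]
    exact hSf.isClosed_biUnion fun O hO => (hSo O hO).1
  have : LocallyCompactSpace Z := hZc.isClosedEmbedding_subtypeVal.locallyCompactSpace
  have : Finite S := hSf
  let : TopologicalSpace S := ⊥
  have : DiscreteTopology S := ⟨rfl⟩
  have hex : ∀ z : Z, ∃ O : S, (z : X) ∈ (O : Set X) := fun z => by
    obtain ⟨O, hO, hz⟩ := hSZ.ge z.2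
    exact ⟨⟨O, hO⟩, hz⟩
  choose p hp using hex
  choose x hx using fun O : S => (hSo O O.2).2
  have hpu : ∀ (z : Z) (O : S), (z : X) ∈ (O : Set X) → p z = O := fun z O hz => by
    by_contra hne
    exact Set.disjoint_left.1 (hSd (p z).2 O.2 fun he => hne (Subtype.ext he)) (hp z) hz
  have hsub : ∀ O : S, (O : Set X) ⊆ Z := fun O => (Set.subset_sUnion_of_mem O.2).trans hSZ.le
  have hpc : Continuous p := by
    refine continuous_iff_isClosed.2 fun A _ => ?_
    have hA : p ⁻¹' A = ⋃ O ∈ A, Subtype.val ⁻¹' (O : Set X) := by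
      ext z
      simp only [Set.mem_preimage, Set.mem_iUnion, exists_prop]
      exact ⟨fun hz => ⟨p z, hz, hp z⟩, fun ⟨O, hO, hz⟩ => hpu z O hz ▸ hO⟩
    rw [hA]
    exact A.toFinite.isClosed_biUnion fun O _ => (hSo O O.2).1.preimage continuous_subtype_val
  refine actsByZero_schwartzRep_of_fibers hpc (fun g z => hpu _ _ ?_)
    (Z := fun O => MulAction.orbit G (x O))
    (fun O z => ⟨z.1, hsub O ((hx O).ge z.2)⟩) (fun O => ?_) (fun O g z => rfl) ?_ χ gs
    fun O => h (x O)
  · have := hp z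
    rw [hx] at this ⊢
    exact MulAction.mem_orbit_of_mem_orbit g this
  · refine .of_comp (g := Subtype.val) .subtypeVal ?_
    have := (hSo O O.2).1
    rw [hx] at this
    exact this.isClosedEmbedding_subtypeVal
  · rintro O z rfl
    exact ⟨⟨z.1, (hx _).le (hp z)⟩, rfl⟩

end Schwartz

/-! ### Compactly supported sections of sheaves -/

namespace LSheaf

variable {X : Type u} [TopologicalSpace X]

/-- The nonzero locus is closed, hence compact: if a germ vanishes at a point, its representing
section vanishes on a neighbourhood. -/
theorem isLocalSections_gammaC (F : LSheaf X) {Z : Type*} [TopologicalSpace Z] (i : C(Z, X)) :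
    IsLocalSections (F.GammaC i) where
  indicator U hU s hs := by
    classical
    refine ⟨?_, ?_⟩
    · have hs := hs.1
      rw [continuous_toEtale_iff] at hs ⊢
      intro z
      by_cases hz : z ∈ U
      · obtain ⟨V, f, hf⟩ := hs z
        refine ⟨V, f, ?_⟩
        filter_upwards [hf, hU.isOpen.mem_nhds hz] with z' h1 h2
        rwa [Set.piecewise_eq_of_mem _ _ _ h2]
      · refine ⟨⊤, 0, ?_⟩
        filter_upwards [hU.compl.isOpen.mem_nhds hz] with z' h2
        refine ⟨trivial, ?_⟩
        rw [Set.piecewise_eq_of_notMem _ _ _ h2, map_zero]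
        rfl
    · refine hs.2.of_isClosed_subset isClosed_closure (closure_mono fun z hz h => hz ?_)
      simp [Set.piecewise, h]
  isCompact_support s hs := by
    refine hs.2.of_isClosed_subset ⟨isOpen_iff_mem_nhds.2 fun z hz => ?_⟩ subset_closure
    have hz : s z = 0 := not_not.1 hz
    obtain ⟨U, f, hU⟩ := (F.continuous_toEtale_iff i s).1 hs.1 z
    obtain ⟨hzU, hzf⟩ := hU.self_of_nhds
    obtain ⟨W, hzW, iWU, iWV, hW⟩ := F.presheaf.germ_eq (i z) hzU hzU f 0
      (hzf.symm.trans (hz.trans (map_zero _).symm))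
    filter_upwards [hU, i.continuous.continuousAt.eventually (W.isOpen.mem_nhds hzW)] with z' h1 h2
    obtain ⟨h1U, h1⟩ := h1
    refine not_not.2 ?_
    rw [h1, ← F.presheaf.germ_res_apply iWU (i z') h2, hW, map_zero, map_zero]

/-- Restriction of compactly supported sections along a closed embedding. -/
def gammaRestrict (F : LSheaf X) {Z : Type*} [TopologicalSpace Z] (i : C(Z, X))
    (hi : IsClosedEmbedding i) : F.GammaC (ContinuousMap.id X) →ₗ[ℂ] F.GammaC i where
  toFun s := ⟨fun z => s.1 (i z), s.2.1.comp i.continuous,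
    (hi.isCompact_preimage s.2.2).of_isClosed_subset isClosed_closure
      (closure_minimal (fun _ hz => subset_closure hz) (isClosed_closure.preimage hi.continuous))⟩
  map_add' _ _ := rfl
  map_smul' _ _ := rfl

theorem gammaRestrict_surjective [T2Space X] [LocallyCompactSpace X] [TotallyDisconnectedSpace X]
    (F : LSheaf X) {Z : Type*} [TopologicalSpace Z] (i : C(Z, X)) (hi : IsClosedEmbedding i) :
    Function.Surjective (F.gammaRestrict i hi) := by
  classical
  intro s
  have hloc : ∀ z, ∃ t ∈ F.GammaC (ContinuousMap.id X), ∀ᶠ z' in 𝓝 z, t (i z') = s.1 z' :=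
    fun z => ?_
  · obtain ⟨t, ht, h⟩ := (F.isLocalSections_gammaC (ContinuousMap.id X)).exists_extension
      hi.isInducing s.1 ((F.isLocalSections_gammaC i).isCompact_support s.1 s.2) hloc
    exact ⟨⟨t, ht⟩, Subtype.ext (funext h)⟩
  · obtain ⟨U, f, hf⟩ := (F.continuous_toEtale_iff i s.1).1 s.2.1 z
    obtain ⟨hzU, -⟩ := hf.self_of_nhds
    obtain ⟨K, hK, hKc, hzK, hKU⟩ := exists_isClopen_subset (U.isOpen.mem_nhds hzU)
    -- Extension by zero of `f` from the compact clopen set `K` inside its domain `U`.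
    refine ⟨fun x => if h : x ∈ K then F.presheaf.germ U x (hKU h) f else 0, ⟨?_, ?_⟩, ?_⟩
    · rw [continuous_toEtale_iff]
      intro x
      by_cases hx : x ∈ K
      · refine ⟨U, f, ?_⟩
        filter_upwards [hK.isOpen.mem_nhds hx] with y hy
        exact ⟨hKU hy, dif_pos hy⟩
      · refine ⟨⊤, 0, ?_⟩
        filter_upwards [hK.compl.isOpen.mem_nhds hx] with y hy
        exact ⟨trivial, (dif_neg hy).trans (map_zero _).symm⟩
    · refine hKc.of_isClosed_subset isClosed_closure (closure_minimal (fun x hx => ?_) hK.1)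
      by_contra h
      exact hx (dif_neg h)
    · filter_upwards [hf, (hK.isOpen.preimage i.continuous).mem_nhds hzK] with z' h1 h2
      obtain ⟨_, h1⟩ := h1
      exact (dif_pos h2).trans h1.symm

end LSheaf

theorem EquivariantLSheaf.actsByZero_globalRep_of_fibers {G : Type*} [Group G] [TopologicalSpace G]
    {X : Type u} [TopologicalSpace X] [T2Space X] [LocallyCompactSpace X]
    [TotallyDisconnectedSpace X] [MulAction G X] [ContinuousConstSMul G X]
    {Y : Type*} [TopologicalSpace Y] [T2Space Y] [LocallyCompactSpace Y]
    [TotallyDisconnectedSpace Y] {π : X → Y} (hπc : Continuous π)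
    (hπ : ∀ (g : G) (x : X), π (g • x) = π x) (χ : G →* ℂˣ) (gs : List G)
    (F : EquivariantLSheaf G X)
    (h : ∀ y : Y, ActsByZero (F.restrictRep (invariantFiber π hπ y)) χ gs) :
    ActsByZero F.globalRep χ gs := by
  have hcl : ∀ y, IsClosedEmbedding
      (⟨Subtype.val, continuous_subtype_val⟩ : C(invariantFiber π hπ y, X)) := fun y =>
    (isClosed_singleton.preimage hπc : IsClosed (π ⁻¹' {y})).isClosedEmbedding_subtypeVal
  refine (F.sheaf.isLocalSections_gammaC (ContinuousMap.id X)).actsByZero hπc F.globalRep ?_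
    (fun y => F.restrictRep (invariantFiber π hπ y)) (fun y => F.sheaf.gammaRestrict _ (hcl y))
    (fun y g s => rfl) (fun y => F.sheaf.gammaRestrict_surjective _ (hcl y)) ?_ χ gs h
  -- Invariance of `π` puts `x` and `g⁻¹ • x` on the same side of `π ⁻¹' A`, so the cutoff commutes
  -- with `g`.
  · rintro U hU ⟨A, rfl⟩ g s
    ext x
    change _ = F.act g (g⁻¹ • x) x _
      (((F.sheaf.isLocalSections_gammaC (ContinuousMap.id X)).cutoff _ hU s).1 (g⁻¹ • x))
    by_cases hx : x ∈ π ⁻¹' A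
    · rw [IsLocalSections.cutoff_of_mem _ _ _ hx,
        IsLocalSections.cutoff_of_mem _ _ _ (show g⁻¹ • x ∈ π ⁻¹' A by rwa [Set.mem_preimage, hπ])]
      rfl
    · rw [IsLocalSections.cutoff_of_notMem _ _ _ hx,
        IsLocalSections.cutoff_of_notMem _ _ _ (show g⁻¹ • x ∉ π ⁻¹' A by rwa [Set.mem_preimage, hπ])]
      exact (map_zero _).symm
  · rintro y s hs x hx
    exact congrFun (congrArg Subtype.val hs) (⟨x, hx⟩ : invariantFiber π hπ y)

theorem proposition3p7
    {G : Type*} [Group G] [TopologicalSpace G] [IsLGroup G]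
    {X : Type u} [TopologicalSpace X] [IsLSpace X] [MulAction G X] [ContinuousSMul G X]
    {Y : Type*} [TopologicalSpace Y] [IsLSpace Y]
    (π : X → Y) (hπc : Continuous π) (hπ : ∀ (g : G) (x : X), π (g • x) = π x)
    (χ : G →* ℂˣ) (hχ : IsLocallyConstant χ) (gs : List G) :
    (∀ F : EquivariantLSheaf G X,
        (∀ y : Y, ActsByZero (F.restrictRep (invariantFiber π hπ y)) χ gs) →
          ActsByZero F.globalRep χ gs) ∧
    ((∀ y : Y, IsFiniteDisjointUnionOfClosedOrbits G (π ⁻¹' {y})) →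
      (∀ x : X, ActsByZero (schwartzRep G (MulAction.orbit G x)) χ gs) →
        ActsByZero (schwartzRep G X) χ gs) := by
  refine ⟨fun F h => F.actsByZero_globalRep_of_fibers hπc hπ χ gs h, fun hfin h => ?_⟩
  have : ∀ y, ContinuousConstSMul G (invariantFiber π hπ y) := fun y =>
    IsInducing.subtypeVal.continuousConstSMul id rfl
  -- Localize along `π` to reach its fibers, then split each fiber into its closed orbits.
  exact actsByZero_schwartzRep_of_fibers hπc hπ (fun y (z : invariantFiber π hπ y) => (z : X))
    (fun y => (isClosed_singleton.preimage hπc : IsClosed (π ⁻¹' {y})).isClosedEmbedding_subtypeVal)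
    (fun _ _ _ => rfl) (fun y x hx => ⟨⟨x, hx⟩, rfl⟩) χ gs
    fun y => actsByZero_schwartzRep_of_orbits χ gs _ (hfin y) h
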